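/- Let $W$ be a discrete memoryless channel with input alphabet $\{1,2\}$ and output alphabet $\{1,\dots,K\}$, with transition probabilities $W(k|j)>0$ for all $j\in\{1,2\}$, $k\in\{1,\dots,K\}$, whose two rows $W(\cdot|1)$ and $W(\cdot|2)$ are not identical (equivalently, $C(W)>0$). Let $q:\{1,2\}\times\{1,\dots,K\}\to\mathbb{R}$ be a decoding metric, extended additively to sequences by $q(\mathbf{x},\mathbf{y})=\sum_{i=1}^n q(x_i,y_i)$. A codebook $\mathcal{C}_n$ is a set of input sequences of length $n$; one of them is sent, chosen uniformly at random, and the output is distributed as $W^n(\mathbf{y}|\mathbf{x})=\prod_{i=1}^n W(y_i|x_i)$. The $q$-decoder chooses the codeword maximizing $q(\cdot,\mathbf{y})$, ties being counted as errors. A rate $R>0$ is achievable (respectively, achievable with $q$-decoding) if for every $\epsilon>0$ there is a sequence of codebooks $\{\mathcal{C}_n\}_{n\ge1}$ with $|\mathcal{C}_n|\ge 2^{n(R-\epsilon)}$ whose average error probability $P_e(\mathcal{C}_n)$ under some choice of decoders (respectively, under the $q$-decoder) satisfies $\liminf_{n\to\infty}P_e(\mathcal{C}_n)=0$. The capacity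 $C(W)$ and the mismatch capacity $C_q(W)$ are the suprema of the achievable rates and of the rates achievable with $q$-decoding, respectively (the supremum being $0$ if there are none). Two real sequences $\{\alpha_k\}_{k=1}^K$, $\{\beta_k\}_{k=1}^K$ are said to have the same order if, for all $1\le k_1,k_2\le K$, $\alpha_{k_1}\ge\alpha_{k_2}$ implies $\beta_{k_1}\ge\beta_{k_2}$. If the sequences $\{\log W(k|1)-\log W(k|2)\}_{k=1}^K$ and $\{q(1,k)-q(2,k)\}_{k=1}^K$ do not have the same order, then $C_q(W)<C(W)$. -/

import Mathlib

namespace Mismatch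

/-- A discrete memoryless channel with input alphabet `X` and output alphabet `Y`:
`W.prob j k` is the transition probability `W(k|j)`. -/
structure Channel (X Y : Type) [Fintype Y] where
  prob : X → Y → ℝ
  nonneg : ∀ j k, 0 ≤ prob j k
  sum_eq_one : ∀ j, ∑ k, prob j k = 1

section Coding

variable {X Y : Type} [Fintype Y]

/-- The memoryless extension `W^n(y|x) = ∏ i, W(y_i|x_i)`. -/
noncomputable def Channel.seqProb (W : Channel X Y) {n : ℕ} (x : Fin n → X) (y : Fin n → Y) : ℝ :=
  ∏ i, W.prob (x i) (y i)

open Classical in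
/-- Average error probability (equiprobable codewords) of the codebook `C` with the decoder `g`,
a map from output sequences to codeword estimates. -/
noncomputable def decoderErrorProb (W : Channel X Y) {n : ℕ} (C : Finset (Fin n → X))
    (g : (Fin n → Y) → (Fin n → X)) : ℝ :=
  (C.card : ℝ)⁻¹ * ∑ x ∈ C, ∑ y : Fin n → Y, if g y ≠ x then W.seqProb x y else 0

/-- The additive extension of a decoding metric to sequences. -/
noncomputable def seqMetric (q : X → Y → ℝ) {n : ℕ} (x : Fin n → X) (y : Fin n → Y) : ℝ :=
  ∑ i, q (x i) (y i)

/-- The `q`-decoder is correct when `x ∈ C` is sent and `y` is received: `x` is the unique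
maximiser of the metric over the codebook, so that ties count as errors. -/
def MetricCorrect (q : X → Y → ℝ) {n : ℕ} (C : Finset (Fin n → X))
    (x : Fin n → X) (y : Fin n → Y) : Prop :=
  ∀ x' ∈ C, x' ≠ x → seqMetric q x' y < seqMetric q x y

open Classical in
/-- Average error probability of the codebook `C` under `q`-decoding. -/
noncomputable def metricErrorProb (W : Channel X Y) (q : X → Y → ℝ) {n : ℕ}
    (C : Finset (Fin n → X)) : ℝ :=
  (C.card : ℝ)⁻¹ *
    ∑ x ∈ C, ∑ y : Fin n → Y, if ¬ MetricCorrect q C x y then W.seqProb x y else 0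

/-- The rate `R > 0` is achievable over `W` (the decoder may be chosen freely). -/
def Achievable (W : Channel X Y) (R : ℝ) : Prop :=
  0 < R ∧ ∀ ε : ℝ, 0 < ε →
    ∃ (C : (n : ℕ) → Finset (Fin n → X)) (g : (n : ℕ) → (Fin n → Y) → (Fin n → X)),
      (∀ n : ℕ, 1 ≤ n → (2 : ℝ) ^ ((n : ℝ) * (R - ε)) ≤ ((C n).card : ℝ)) ∧
      Filter.liminf (fun n => decoderErrorProb W (C n) (g n)) Filter.atTop = 0

/-- The rate `R > 0` is achievable over `W` with `q`-decoding. -/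
def MetricAchievable (W : Channel X Y) (q : X → Y → ℝ) (R : ℝ) : Prop :=
  0 < R ∧ ∀ ε : ℝ, 0 < ε →
    ∃ C : (n : ℕ) → Finset (Fin n → X),
      (∀ n : ℕ, 1 ≤ n → (2 : ℝ) ^ ((n : ℝ) * (R - ε)) ≤ ((C n).card : ℝ)) ∧
      Filter.liminf (fun n => metricErrorProb W q (C n)) Filter.atTop = 0

/-- The capacity `C(W)`, in bits per channel use. It is `0` if no positive rate is achievable;
for a finite input alphabet the achievable rates are bounded. -/
noncomputable def capacity (W : Channel X Y) : ℝ :=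
  sSup {R : ℝ | Achievable W R}

/-- The mismatch capacity `C_q(W)`, with the same conventions. -/
noncomputable def mismatchCapacity (W : Channel X Y) (q : X → Y → ℝ) : ℝ :=
  sSup {R : ℝ | MetricAchievable W q R}

end Coding

/-- Two finite real sequences have the same order. -/
def SameOrder {K : ℕ} (a b : Fin K → ℝ) : Prop :=
  ∀ i₁ i₂ : Fin K, a i₁ ≥ a i₂ → b i₁ ≥ b i₂

end Mismatch

namespace Mismatch

section SequenceSums

variable {X Y Ω : Type} [Fintype Y] [Fintype Ω]

theorem sum_prod_apply {n : ℕ} (g : Fin n → Y → ℝ) :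
    ∑ y : Fin n → Y, ∏ i, g i (y i) = ∏ i, ∑ k, g i k := by
  rw [Finset.prod_univ_sum, Fintype.piFinset_univ]

theorem Channel.seqProb_nonneg (W : Channel X Y) {n : ℕ} (x : Fin n → X) (y : Fin n → Y) :
    0 ≤ W.seqProb x y :=
  Finset.prod_nonneg fun _ _ => W.nonneg _ _

theorem Channel.sum_seqProb (W : Channel X Y) {n : ℕ} (x : Fin n → X) :
    ∑ y, W.seqProb x y = 1 := by
  unfold Channel.seqProb
  rw [sum_prod_apply fun i k => W.prob (x i) k]
  simp [W.sum_eq_one]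

/-- Change of variables for a memoryless channel that is the image of a memoryless source. -/
theorem Channel.sum_seqProb_mul [DecidableEq Y] (W : Channel X Y) (κ : X → Ω → ℝ) (f : Ω → Y)
    (hW : ∀ x k, W.prob x k = ∑ ω, if f ω = k then κ x ω else 0)
    {n : ℕ} (x : Fin n → X) (F : (Fin n → Y) → ℝ) :
    ∑ y, W.seqProb x y * F y =
      ∑ ω : Fin n → Ω, (∏ i, κ (x i) (ω i)) * F (fun i => f (ω i)) := by
  have h : ∀ y, W.seqProb x y =
      ∑ ω : Fin n → Ω, ∏ i, if f (ω i) = y i then κ (x i) (ω i) else 0 := by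
    intro y
    unfold Channel.seqProb
    rw [sum_prod_apply fun i ω => if f ω = y i then κ (x i) ω else 0]
    exact Finset.prod_congr rfl fun i _ => hW _ _
  simp_rw [h, Finset.sum_mul]
  rw [Finset.sum_comm]
  refine Finset.sum_congr rfl fun ω _ => ?_
  rw [Finset.sum_eq_single (fun i => f (ω i))]
  · simp
  · intro y _ hy
    obtain ⟨i, hi⟩ := Function.ne_iff.mp hy
    rw [Finset.prod_eq_zero (Finset.mem_univ i), zero_mul]
    rw [if_neg (Ne.symm hi)]
  · simp

open Classical in
theorem metricErrorProb_eq (W : Channel X Y) (q : X → Y → ℝ) {n : ℕ} (C : Finset (Fin n → X)) :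
    metricErrorProb W q C = (C.card : ℝ)⁻¹ *
      ∑ x ∈ C, ∑ y, W.seqProb x y * if ¬ MetricCorrect q C x y then 1 else 0 := by
  simp [metricErrorProb]

/-- If an output of `V` can be coupled, letter by letter, with a family of outputs of `W` on which
wrong inputs do on average at least as well, then a `q`-decoding error for `V` forces one for some
member of the family. -/
theorem metricErrorProb_le_of_coupling [DecidableEq Y] {J : Type} [Fintype J] [Nonempty J] (W V : Channel X Y)
    (q : X → Y → ℝ) (κ : X → Ω → ℝ) (hκ : ∀ x ω, 0 ≤ κ x ω) (f : J → Ω → Y) (g : Ω → Y)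
    (hW : ∀ j x k, W.prob x k = ∑ ω, if f j ω = k then κ x ω else 0)
    (hV : ∀ x k, V.prob x k = ∑ ω, if g ω = k then κ x ω else 0)
    (hq : ∀ x ω, κ x ω ≠ 0 → ∀ x',
      Fintype.card J * (q x' (g ω) - q x (g ω)) ≤ ∑ j, (q x' (f j ω) - q x (f j ω)))
    {n : ℕ} (C : Finset (Fin n → X)) :
    metricErrorProb V q C ≤ Fintype.card J * metricErrorProb W q C := by
  classical
  rw [metricErrorProb_eq, metricErrorProb_eq, mul_left_comm]
  refine mul_le_mul_of_nonneg_left ?_ (inv_nonneg.mpr (Nat.cast_nonneg _))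
  rw [Finset.mul_sum]
  refine Finset.sum_le_sum fun x _ => ?_
  have hc : ∀ a : ℝ, (Fintype.card J : ℝ) * a = ∑ _j : J, a := by simp
  rw [hc, V.sum_seqProb_mul κ g hV]
  rw [Finset.sum_congr rfl fun j _ => W.sum_seqProb_mul κ (f j) (hW j) x
    fun y => if ¬ MetricCorrect q C x y then (1 : ℝ) else 0, Finset.sum_comm]
  refine Finset.sum_le_sum fun ω _ => ?_
  rw [← Finset.mul_sum]
  by_cases h0 : ∏ i, κ (x i) (ω i) = 0
  · simp [h0]
  refine mul_le_mul_of_nonneg_left ?_ (Finset.prod_nonneg fun i _ => hκ _ _)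
  have hnn : ∀ j ∈ (Finset.univ : Finset J), (0 : ℝ) ≤
      if ¬ MetricCorrect q C x (fun i => f j (ω i)) then 1 else 0 := by
    intro j _
    split_ifs <;> norm_num
  by_cases herr : MetricCorrect q C x (fun i => g (ω i))
  · rw [if_neg (not_not_intro herr)]
    exact Finset.sum_nonneg hnn
  rw [if_pos herr]
  unfold MetricCorrect at herr
  push Not at herr
  obtain ⟨x', hx', hne, hle⟩ := herr
  have hκ0 : ∀ i, κ (x i) (ω i) ≠ 0 := fun i => Finset.prod_ne_zero_iff.mp h0 i (Finset.mem_univ i)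
  have hsum : 0 ≤ ∑ j, (seqMetric q x' (fun i => f j (ω i)) - seqMetric q x (fun i => f j (ω i))) := by
    calc (0 : ℝ) ≤ Fintype.card J *
          (seqMetric q x' (fun i => g (ω i)) - seqMetric q x (fun i => g (ω i))) :=
          mul_nonneg (by positivity) (by linarith)
      _ = ∑ i, Fintype.card J * (q (x' i) (g (ω i)) - q (x i) (g (ω i))) := by
          rw [seqMetric, seqMetric, ← Finset.sum_sub_distrib, Finset.mul_sum]
      _ ≤ ∑ i, ∑ j, (q (x' i) (f j (ω i)) - q (x i) (f j (ω i))) :=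
          Finset.sum_le_sum fun i _ => hq _ _ (hκ0 i) _
      _ = _ := by
          rw [Finset.sum_comm]
          simp [seqMetric, Finset.sum_sub_distrib]
  obtain ⟨j, hj⟩ : ∃ j, 0 ≤ seqMetric q x' (fun i => f j (ω i)) -
      seqMetric q x (fun i => f j (ω i)) := by
    by_contra! hcon
    exact absurd hsum (not_le.mpr (Finset.sum_neg (fun j _ => hcon j) Finset.univ_nonempty))
  have hone : (1 : ℝ) = if ¬ MetricCorrect q C x (fun i => f j (ω i)) then 1 else 0 := by
    rw [if_pos]
    intro hcor
    have := hcor x' hx' hne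
    linarith
  exact hone.le.trans (Finset.single_le_sum hnn (Finset.mem_univ j))

theorem metricErrorProb_le_one (W : Channel X Y) (q : X → Y → ℝ) {n : ℕ}
    (C : Finset (Fin n → X)) : metricErrorProb W q C ≤ 1 := by
  classical
  have h : ∑ x ∈ C, ∑ y : Fin n → Y, (if ¬ MetricCorrect q C x y then W.seqProb x y else 0) ≤
      (C.card : ℝ) := by
    rw [← nsmul_one, ← Finset.sum_const]
    refine Finset.sum_le_sum fun x _ => ?_
    rw [← W.sum_seqProb x]
    refine Finset.sum_le_sum fun y _ => ?_
    split_ifs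
    · exact W.seqProb_nonneg x y
    · exact le_rfl
  unfold metricErrorProb
  rw [inv_mul_eq_div]
  exact div_le_one_of_le₀ h (by positivity)

end SequenceSums

section LargeDeviations

variable {X Y : Type} [Fintype X] [Fintype Y]

theorem exists_expMoment_lt_one (w f : Y → ℝ) (hw : ∑ k, w k = 1) (hf : ∑ k, w k * f k < 0) :
    ∃ s₀ > 0, ∀ s, 0 < s → s < s₀ → ∑ k, w k * Real.exp (s * f k) < 1 := by
  have hd : HasDerivAt (fun s : ℝ => ∑ k, w k * Real.exp (s * f k)) (∑ k, w k * f k) 0 := by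
    have : ∀ k ∈ (Finset.univ : Finset Y),
        HasDerivAt (fun s : ℝ => w k * Real.exp (s * f k)) (w k * f k) 0 := by
      intro k _
      have := (((hasDerivAt_id (0 : ℝ)).mul_const (f k)).exp).const_mul (w k)
      simpa using this
    exact HasDerivAt.fun_sum this
  have hev := (hasDerivAt_iff_tendsto_slope.mp hd).mono_left
    (nhdsWithin_mono 0 fun s (hs : s ∈ Set.Ioi 0) => ne_of_gt hs)
  have hev' : ∀ᶠ s in nhdsWithin (0 : ℝ) (Set.Ioi 0),
      slope (fun s : ℝ => ∑ k, w k * Real.exp (s * f k)) 0 s < 0 :=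
    hev.eventually (gt_mem_nhds hf)
  obtain ⟨s₀, hs₀, hs⟩ := mem_nhdsGT_iff_exists_Ioo_subset.mp hev'
  refine ⟨s₀, hs₀, fun s h0 h1 => ?_⟩
  have := hs ⟨h0, h1⟩
  simp only [Set.mem_ofPred_eq, slope_def_field, zero_mul, Real.exp_zero, mul_one, hw, sub_zero]
    at this
  rw [div_lt_iff₀ h0, zero_mul] at this
  linarith

open Classical in
/-- Chernoff bound, uniform over input sequences. -/
theorem exists_chernoff_bound (W : Channel X Y) (f : X → Y → ℝ)
    (hf : ∀ x, ∑ k, W.prob x k * f x k < 0) :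
    ∃ ρ : ℝ, 0 < ρ ∧ ρ < 1 ∧ ∀ (n : ℕ) (x : Fin n → X),
      ∑ y : Fin n → Y, (if 0 ≤ ∑ i, f (x i) (y i) then W.seqProb x y else 0) ≤ ρ ^ n := by
  choose s₀ hs₀ hs using fun x => exists_expMoment_lt_one (W.prob x) (f x) (W.sum_eq_one x) (hf x)
  obtain ⟨s, hs1, hs2⟩ : ∃ s : ℝ, 0 < s ∧ ∀ x, s < s₀ x := by
    have : ∀ᶠ s in nhdsWithin (0 : ℝ) (Set.Ioi 0), ∀ x, s < s₀ x :=
      Filter.eventually_all.mpr fun x =>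
        (Filter.Tendsto.eventually_lt_const (hs₀ x) nhdsWithin_le_nhds)
    obtain ⟨s, h1, h2⟩ := (this.and self_mem_nhdsWithin).exists
    exact ⟨s, h2, h1⟩
  obtain ⟨ρ, hρ1, hρ0, hρ⟩ : ∃ ρ : ℝ, ρ < 1 ∧ 0 < ρ ∧
      ∀ x, ∑ k, W.prob x k * Real.exp (s * f x k) < ρ := by
    have h1 : ∀ᶠ ρ in nhdsWithin (1 : ℝ) (Set.Iio 1),
        ∀ x, ∑ k, W.prob x k * Real.exp (s * f x k) < ρ :=
      Filter.eventually_all.mpr fun x =>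
        nhdsWithin_le_nhds (lt_mem_nhds (hs x s hs1 (hs2 x)))
    have h2 : ∀ᶠ ρ in nhdsWithin (1 : ℝ) (Set.Iio 1), 0 < ρ :=
      nhdsWithin_le_nhds (lt_mem_nhds one_pos)
    obtain ⟨ρ, h3, h4, h5⟩ := (h1.and (h2.and self_mem_nhdsWithin)).exists
    exact ⟨ρ, h5, h4, h3⟩
  refine ⟨ρ, hρ0, hρ1, fun n x => ?_⟩
  calc _ ≤ ∑ y : Fin n → Y, ∏ i, (W.prob (x i) (y i) * Real.exp (s * f (x i) (y i))) := by
        refine Finset.sum_le_sum fun y _ => ?_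
        rw [Finset.prod_mul_distrib, ← Real.exp_sum, ← Finset.mul_sum]
        split_ifs with h
        · exact le_mul_of_one_le_right (W.seqProb_nonneg x y)
            (Real.one_le_exp (mul_nonneg hs1.le h))
        · exact mul_nonneg (W.seqProb_nonneg x y) (Real.exp_nonneg _)
    _ = ∏ i, ∑ k, W.prob (x i) k * Real.exp (s * f (x i) k) :=
        sum_prod_apply fun i k => W.prob (x i) k * Real.exp (s * f (x i) k)
    _ ≤ ∏ _i : Fin n, ρ := by
        refine Finset.prod_le_prod (fun i _ => Finset.sum_nonneg fun k _ =>
          mul_nonneg (W.nonneg _ _) (Real.exp_nonneg _)) fun i _ => (hρ _).le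
    _ = ρ ^ n := by simp

end LargeDeviations

section Divergence

variable {X Y : Type} [Fintype Y]

/-- Kullback-Leibler divergence, in nats, between strictly positive distributions. -/
noncomputable def relEntropy (a b : Y → ℝ) : ℝ :=
  ∑ k, a k * (Real.log (a k) - Real.log (b k))

theorem seqProb_eq_exp_mul (W : Channel X Y) (hpos : ∀ x k, 0 < W.prob x k) (Q : Y → ℝ)
    (hQ : ∀ k, 0 < Q k) {n : ℕ} (x : Fin n → X) (y : Fin n → Y) :
    W.seqProb x y =
      Real.exp (∑ i, (Real.log (W.prob (x i) (y i)) - Real.log (Q (y i)))) * ∏ i, Q (y i) := by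
  rw [Real.exp_sum, ← Finset.prod_mul_distrib]
  refine Finset.prod_congr rfl fun i _ => ?_
  rw [Real.exp_sub, Real.exp_log (hpos _ _), Real.exp_log (hQ _), div_mul_cancel₀ _ (hQ _).ne']

/-- Strong converse: a code whose rate exceeds the divergence radius of the channel around some
output distribution cannot be decoded reliably. -/
theorem exists_strong_converse [Fintype X] (V : Channel X Y) (hpos : ∀ x k, 0 < V.prob x k) (Q : Y → ℝ)
    (hQ : ∀ k, 0 < Q k) (hQ1 : ∑ k, Q k = 1) (c : ℝ) (hc : ∀ x, relEntropy (V.prob x) Q < c)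
    (q : X → Y → ℝ) :
    ∃ ρ : ℝ, 0 < ρ ∧ ρ < 1 ∧ ∀ (n : ℕ) (C : Finset (Fin n → X)), C.Nonempty →
      1 - metricErrorProb V q C ≤ ρ ^ n + Real.exp (n * c) / C.card := by
  classical
  obtain ⟨ρ, h0, h1, hρ⟩ := exists_chernoff_bound V
    (fun x k => Real.log (V.prob x k) - Real.log (Q k) - c) (by
      intro x
      have := hc x
      unfold relEntropy at this
      simp only [mul_sub _ _ c, Finset.sum_sub_distrib, ← Finset.sum_mul, V.sum_eq_one]
      linarith)
  refine ⟨ρ, h0, h1, fun n C hC => ?_⟩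
  have hcard : (0 : ℝ) < C.card := by exact_mod_cast hC.card_pos
  have key : (C.card : ℝ) * (1 - metricErrorProb V q C) ≤ C.card * ρ ^ n + Real.exp (n * c) := by
    have e1 : (C.card : ℝ) * (1 - metricErrorProb V q C) =
        ∑ x ∈ C, ∑ y, if MetricCorrect q C x y then V.seqProb x y else 0 := by
      rw [mul_sub, mul_one, metricErrorProb, mul_inv_cancel_left₀ hcard.ne']
      have : (C.card : ℝ) = ∑ x ∈ C, ∑ y, V.seqProb x y := by simp [V.sum_seqProb]
      rw [this, ← Finset.sum_sub_distrib]
      refine Finset.sum_congr rfl fun x _ => ?_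
      rw [← Finset.sum_sub_distrib]
      refine Finset.sum_congr rfl fun y _ => ?_
      by_cases h : MetricCorrect q C x y <;> simp [h]
    have e2 : ∀ x ∈ C, ∑ y, (if MetricCorrect q C x y then V.seqProb x y else 0) ≤
        ρ ^ n + ∑ y, if MetricCorrect q C x y then Real.exp (n * c) * ∏ i, Q (y i) else 0 := by
      intro x _
      refine le_trans ?_ (add_le_add_left (hρ n x) _)
      rw [← Finset.sum_add_distrib]
      refine Finset.sum_le_sum fun y _ => ?_
      have hQn : 0 ≤ Real.exp (n * c) * ∏ i, Q (y i) :=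
        mul_nonneg (Real.exp_nonneg _) (Finset.prod_nonneg fun i _ => (hQ _).le)
      by_cases hcor : MetricCorrect q C x y
      · simp only [hcor, if_true]
        split_ifs with h
        · linarith
        · rw [zero_add, seqProb_eq_exp_mul V hpos Q hQ]
          refine mul_le_mul_of_nonneg_right (Real.exp_le_exp.mpr ?_)
            (Finset.prod_nonneg fun i _ => (hQ _).le)
          rw [Finset.sum_sub_distrib] at h
          simp only [Finset.sum_const, Finset.card_univ, Fintype.card_fin, nsmul_eq_mul] at h
          linarith
      · simp only [hcor, if_false, add_zero]
        split_ifs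
        · exact V.seqProb_nonneg x y
        · exact le_rfl
    have e3 : ∑ x ∈ C, ∑ y : Fin n → Y,
        (if MetricCorrect q C x y then Real.exp (n * c) * ∏ i, Q (y i) else 0) ≤
          Real.exp (n * c) := by
      rw [Finset.sum_comm]
      have hQs : ∑ y : Fin n → Y, Real.exp (n * c) * ∏ i, Q (y i) = Real.exp (n * c) := by
        rw [← Finset.mul_sum, sum_prod_apply fun _ k => Q k]
        simp [hQ1]
      refine le_trans (Finset.sum_le_sum fun y _ => ?_) hQs.le
      have hQn : 0 ≤ Real.exp (n * c) * ∏ i, Q (y i) :=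
        mul_nonneg (Real.exp_nonneg _) (Finset.prod_nonneg fun i _ => (hQ _).le)
      by_cases hex : ∃ x ∈ C, MetricCorrect q C x y
      · obtain ⟨x, hx, hcor⟩ := hex
        rw [Finset.sum_eq_single_of_mem x hx, if_pos hcor]
        intro x' hx' hne
        rw [if_neg]
        intro hcor'
        exact lt_asymm (hcor x' hx' hne) (hcor' x hx hne.symm)
      · push Not at hex
        rw [Finset.sum_eq_zero fun x hx => if_neg (hex x hx)]
        exact hQn
    rw [e1]
    refine (Finset.sum_le_sum e2).trans ?_
    rw [Finset.sum_add_distrib, Finset.sum_const, nsmul_eq_mul]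
    linarith
  rw [← le_div_iff₀' hcard, add_div, mul_div_cancel_left₀ _ hcard.ne'] at key
  exact key

end Divergence

section Achievability

variable {X Y : Type} [Fintype Y]

theorem decoderErrorProb_nonneg (W : Channel X Y) {n : ℕ} (C : Finset (Fin n → X))
    (g : (Fin n → Y) → (Fin n → X)) : 0 ≤ decoderErrorProb W C g := by
  classical
  refine mul_nonneg (inv_nonneg.mpr (Nat.cast_nonneg _))
    (Finset.sum_nonneg fun x _ => Finset.sum_nonneg fun y _ => ?_)
  split_ifs
  · exact W.seqProb_nonneg x y
  · exact le_rfl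

variable [Fintype X]

/-- Feinstein's maximal code argument: a code that cannot be extended has decoding regions covering
every output distribution to extent `r`, so it has many codewords. -/
theorem exists_maximal_code [Nonempty X] (W : Channel X Y) (p : X → ℝ) (hp : ∀ x, 0 ≤ p x)
    (hp1 : ∑ x, p x = 1) {n : ℕ} (B : (Fin n → X) → (Fin n → Y) → Prop) (r a : ℝ)
    (hr : r ≤ 1 / 3) (hr0 : 0 ≤ r)
    (hB : ∀ x y, B x y → a * ∏ i, (∑ j, p j * W.prob j (y i)) ≤ W.seqProb x y)
    (ha : 0 ≤ a)
    (hBr : ∀ x, 1 - r ≤ ∑ y, open Classical in if B x y then W.seqProb x y else 0) :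
    ∃ (C : Finset (Fin n → X)) (g : (Fin n → Y) → (Fin n → X)),
      decoderErrorProb W C g ≤ 2 * r ∧ r * a ≤ C.card := by
  classical
  let Good : Finset (Fin n → X) → ((Fin n → Y) → (Fin n → X)) → Prop := fun C g =>
    ∀ x ∈ C, 1 - 2 * r ≤ ∑ y, if B x y ∧ g y = x then W.seqProb x y else 0
  obtain ⟨C, hC, hmax⟩ := Finset.exists_max_image
    (Finset.univ.filter fun C : Finset (Fin n → X) => ∃ g, Good C g) Finset.card
    ⟨∅, by
      rw [Finset.mem_filter]
      exact ⟨Finset.mem_univ _, fun _ _ => Classical.arbitrary X, by simp [Good]⟩⟩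
  obtain ⟨g, hg⟩ := (Finset.mem_filter.mp hC).2
  refine ⟨C, g, ?_, ?_⟩
  · unfold decoderErrorProb
    have h : ∑ x ∈ C, ∑ y, (if g y ≠ x then W.seqProb x y else 0) ≤ (C.card : ℝ) * (2 * r) := by
      rw [← nsmul_eq_mul, ← Finset.sum_const]
      refine Finset.sum_le_sum fun x hx => ?_
      have h1 := hg x hx
      have h2 : ∑ y, (if g y ≠ x then W.seqProb x y else 0) +
          ∑ y, (if B x y ∧ g y = x then W.seqProb x y else 0) ≤ ∑ y, W.seqProb x y := by
        rw [← Finset.sum_add_distrib]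
        refine Finset.sum_le_sum fun y _ => ?_
        have := W.seqProb_nonneg x y
        by_cases h3 : g y = x <;> by_cases h4 : B x y <;> simp [h3, h4, this]
      rw [W.sum_seqProb] at h2
      linarith
    rcases C.eq_empty_or_nonempty with rfl | hne
    · simpa using hr0
    · have hcard : (0 : ℝ) < C.card := by exact_mod_cast hne.card_pos
      rwa [inv_mul_le_iff₀ hcard]
  · let U : (Fin n → Y) → Prop := fun y => g y ∈ C ∧ B (g y) y
    have hU : ∀ x, r ≤ ∑ y, if U y then W.seqProb x y else 0 := by
      intro x
      by_cases hx : x ∈ C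
      · have h1 : ∑ y, (if B x y ∧ g y = x then W.seqProb x y else 0) ≤
            ∑ y, if U y then W.seqProb x y else 0 := by
          refine Finset.sum_le_sum fun y _ => ?_
          by_cases h3 : B x y ∧ g y = x
          · have h4 : U y := by
              obtain ⟨h5, h6⟩ := h3
              exact ⟨h6 ▸ hx, h6.symm ▸ h5⟩
            simp [h3, h4]
          · rw [if_neg h3]
            have := W.seqProb_nonneg x y
            split_ifs <;> simp [this]
        have := hg x hx
        linarith
      · have h1 : ∑ y, (if B x y ∧ ¬ U y then W.seqProb x y else 0) < 1 - 2 * r := by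
          by_contra! hcon
          have hgood : Good (insert x C) fun y => if B x y ∧ ¬ U y then x else g y := by
            intro x' hx'
            rw [Finset.mem_insert] at hx'
            rcases hx' with rfl | hx'
            · refine hcon.trans (Finset.sum_le_sum fun y _ => ?_)
              by_cases h3 : B x' y ∧ ¬ U y
              · simp [h3]
              · rw [if_neg h3]
                have := W.seqProb_nonneg x' y
                split_ifs <;> simp [this]
            · refine (hg x' hx').trans (Finset.sum_le_sum fun y _ => ?_)
              by_cases h3 : B x' y ∧ g y = x'
              · have h4 : U y := by
                  obtain ⟨h5, h6⟩ := h3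
                  exact ⟨h6 ▸ hx', h6.symm ▸ h5⟩
                simp [h3, h4]
              · rw [if_neg h3]
                have := W.seqProb_nonneg x' y
                split_ifs <;> simp [this]
          have := hmax (insert x C) (Finset.mem_filter.mpr ⟨Finset.mem_univ _, _, hgood⟩)
          rw [Finset.card_insert_of_notMem hx] at this
          omega
        have h2 : ∑ y, (if B x y then W.seqProb x y else 0) ≤
            ∑ y, (if B x y ∧ ¬ U y then W.seqProb x y else 0) +
              ∑ y, if U y then W.seqProb x y else 0 := by
          rw [← Finset.sum_add_distrib]
          refine Finset.sum_le_sum fun y _ => ?_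
          have := W.seqProb_nonneg x y
          by_cases h3 : B x y <;> by_cases h4 : U y <;> simp [h3, h4, this]
        have := hBr x
        linarith
    have hp_sum : ∑ x : Fin n → X, ∏ i, p (x i) = 1 := by
      rw [sum_prod_apply fun _ j => p j]
      simp [hp1]
    have hlow : r ≤ ∑ y, if U y then ∏ i, (∑ j, p j * W.prob j (y i)) else 0 := by
      calc r = ∑ x : Fin n → X, (∏ i, p (x i)) * r := by
            rw [← Finset.sum_mul, hp_sum, one_mul]
        _ ≤ ∑ x : Fin n → X, (∏ i, p (x i)) * ∑ y, if U y then W.seqProb x y else 0 :=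
            Finset.sum_le_sum fun x _ =>
              mul_le_mul_of_nonneg_left (hU x) (Finset.prod_nonneg fun i _ => hp _)
        _ = ∑ y, ∑ x : Fin n → X, if U y then (∏ i, p (x i)) * W.seqProb x y else 0 := by
            simp_rw [Finset.mul_sum, mul_ite, mul_zero]
            exact Finset.sum_comm
        _ = _ := by
            refine Finset.sum_congr rfl fun y _ => ?_
            split_ifs
            · rw [← sum_prod_apply fun i j => p j * W.prob j (y i)]
              exact Finset.sum_congr rfl fun x _ => Finset.prod_mul_distrib.symm
            · simp
    have hup : a * ∑ y, (if U y then ∏ i, (∑ j, p j * W.prob j (y i)) else 0) ≤ C.card := by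
      calc _ = ∑ y, if U y then a * ∏ i, (∑ j, p j * W.prob j (y i)) else 0 := by
            rw [Finset.mul_sum]
            exact Finset.sum_congr rfl fun y _ => by split_ifs <;> simp
        _ ≤ ∑ y, ∑ x ∈ C, W.seqProb x y * if g y = x then 1 else 0 := by
            refine Finset.sum_le_sum fun y _ => ?_
            split_ifs with h
            · rw [Finset.sum_eq_single_of_mem (g y) h.1]
              · simpa using hB _ _ h.2
              · intro x _ hx
                simp [hx.symm]
            · refine Finset.sum_nonneg fun x _ => mul_nonneg (W.seqProb_nonneg x y) ?_
              split_ifs <;> norm_num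
        _ ≤ ∑ x ∈ C, ∑ y, W.seqProb x y := by
            rw [Finset.sum_comm]
            refine Finset.sum_le_sum fun x _ => Finset.sum_le_sum fun y _ => ?_
            refine mul_le_of_le_one_right (W.seqProb_nonneg x y) ?_
            split_ifs <;> norm_num
        _ = C.card := by simp [W.sum_seqProb]
    calc r * a = a * r := mul_comm _ _
      _ ≤ _ := (mul_le_mul_of_nonneg_left hlow ha).trans hup

theorem exists_reliable_codes [Nonempty X] (W : Channel X Y) (hpos : ∀ x k, 0 < W.prob x k)
    (p : X → ℝ) (hp : ∀ x, 0 ≤ p x) (hp1 : ∑ x, p x = 1) (Q : Y → ℝ)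
    (hQ : ∀ k, Q k = ∑ j, p j * W.prob j k) (hQ0 : ∀ k, 0 < Q k) (c : ℝ)
    (hc : ∀ x, c ≤ relEntropy (W.prob x) Q) (δ : ℝ) (hδ : 0 < δ) :
    ∃ ρ : ℝ, 0 < ρ ∧ ρ < 1 ∧ ∀ n : ℕ, ρ ^ n ≤ 1 / 3 →
      ∃ (C : Finset (Fin n → X)) (g : (Fin n → Y) → (Fin n → X)),
        decoderErrorProb W C g ≤ 2 * ρ ^ n ∧ Real.exp (n * (c - 2 * δ)) ≤ C.card := by
  classical
  obtain ⟨ρ, h0, h1, hρ⟩ := exists_chernoff_bound W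
    (fun x k => (c - δ) - (Real.log (W.prob x k) - Real.log (Q k))) (by
      intro x
      have := hc x
      unfold relEntropy at this
      rw [Finset.sum_congr rfl fun k _ => mul_sub (W.prob x k) (c - δ)
        (Real.log (W.prob x k) - Real.log (Q k)), Finset.sum_sub_distrib, ← Finset.sum_mul,
        W.sum_eq_one]
      linarith)
  refine ⟨max ρ (Real.exp (-δ)), lt_max_of_lt_left h0,
    max_lt h1 (by simpa using hδ), fun n hn => ?_⟩
  obtain ⟨C, g, hC, hcard⟩ := exists_maximal_code W p hp hp1
    (fun x y => ∑ i : Fin n, ((c - δ) - (Real.log (W.prob (x i) (y i)) - Real.log (Q (y i)))) < 0)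
    (max ρ (Real.exp (-δ)) ^ n) (Real.exp (n * (c - δ))) hn
    (pow_nonneg (le_max_of_le_left h0.le) n) (by
      intro x y hxy
      simp_rw [← hQ]
      rw [seqProb_eq_exp_mul W hpos Q hQ0]
      refine mul_le_mul_of_nonneg_right (Real.exp_le_exp.mpr ?_)
        (Finset.prod_nonneg fun i _ => (hQ0 _).le)
      rw [Finset.sum_sub_distrib] at hxy
      simp only [Finset.sum_const, Finset.card_univ, Fintype.card_fin, nsmul_eq_mul] at hxy
      linarith) (Real.exp_nonneg _) (by
      intro x
      have h2 := hρ n x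
      have h3 : ρ ^ n ≤ max ρ (Real.exp (-δ)) ^ n := pow_le_pow_left₀ h0.le (le_max_left _ _) n
      have h4 : ∑ y, W.seqProb x y = 1 := W.sum_seqProb x
      rw [sub_le_iff_le_add, ← h4]
      refine le_trans ?_ (add_le_add_right (h2.trans h3) _)
      rw [← Finset.sum_add_distrib]
      refine Finset.sum_le_sum fun y _ => ?_
      rcases lt_or_ge (∑ i : Fin n,
        ((c - δ) - (Real.log (W.prob (x i) (y i)) - Real.log (Q (y i))))) 0 with h | h
      · rw [if_pos h, if_neg (not_le.mpr h), add_zero]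
      · rw [if_neg (not_lt.mpr h), if_pos h, zero_add])
  refine ⟨C, g, hC, le_trans ?_ hcard⟩
  calc Real.exp (n * (c - 2 * δ)) = Real.exp (-δ) ^ n * Real.exp (n * (c - δ)) := by
        rw [← Real.exp_nat_mul, ← Real.exp_add]
        ring_nf
    _ ≤ _ := mul_le_mul_of_nonneg_right
        (pow_le_pow_left₀ (Real.exp_nonneg _) (le_max_right _ _) n) (Real.exp_nonneg _)

theorem two_rpow_eq_exp (x : ℝ) : (2 : ℝ) ^ x = Real.exp (x * Real.log 2) := by
  rw [Real.rpow_def_of_pos two_pos, mul_comm]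

theorem bddAbove_achievable (W : Channel X Y) : BddAbove {R : ℝ | Achievable W R} := by
  refine ⟨Real.logb 2 (Fintype.card X), fun R hR => le_of_forall_pos_le_add fun ε hε => ?_⟩
  obtain ⟨C, g, hC, -⟩ := hR.2 ε hε
  have h1 := hC 1 le_rfl
  have h2 : ((C 1).card : ℝ) ≤ Fintype.card X := by
    have : (C 1).card ≤ Fintype.card X := by
      simpa using (C 1).card_le_univ
    exact_mod_cast this
  have h3 : (2 : ℝ) ^ (R - ε) ≤ Fintype.card X := by
    refine le_trans ?_ h2
    simpa using h1
  have h4 : (0 : ℝ) < Fintype.card X := lt_of_lt_of_le (Real.rpow_pos_of_pos two_pos _) h3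
  have := (Real.le_logb_iff_rpow_le one_lt_two h4).mpr h3
  linarith

theorem le_capacity_of_le_relEntropy [Nonempty X] (W : Channel X Y)
    (hpos : ∀ x k, 0 < W.prob x k)
    (p : X → ℝ) (hp : ∀ x, 0 ≤ p x) (hp1 : ∑ x, p x = 1) (Q : Y → ℝ)
    (hQ : ∀ k, Q k = ∑ j, p j * W.prob j k) (hQ0 : ∀ k, 0 < Q k) (c : ℝ) (hc0 : 0 < c)
    (hc : ∀ x, c ≤ relEntropy (W.prob x) Q) (hcX : c ≤ Real.log (Fintype.card X)) :
    c / Real.log 2 ≤ capacity W := by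
  have hlog : 0 < Real.log 2 := Real.log_pos one_lt_two
  refine le_csSup (bddAbove_achievable W) ⟨div_pos hc0 hlog, fun ε hε => ?_⟩
  obtain ⟨ρ, h0, h1, hρ⟩ := exists_reliable_codes W hpos p hp hp1 Q hQ hQ0 c hc
    (ε * Real.log 2 / 2) (by positivity)
  have hrate : ∀ n : ℕ, (2 : ℝ) ^ ((n : ℝ) * (c / Real.log 2 - ε)) =
      Real.exp (n * (c - 2 * (ε * Real.log 2 / 2))) := by
    intro n
    rw [two_rpow_eq_exp]
    congr 1
    field_simp
  have hcodes : ∀ n : ℕ, ∃ (C : Finset (Fin n → X)) (g : (Fin n → Y) → (Fin n → X)),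
      (2 : ℝ) ^ ((n : ℝ) * (c / Real.log 2 - ε)) ≤ (C.card : ℝ) ∧
      (ρ ^ n ≤ 1 / 3 → decoderErrorProb W C g ≤ 2 * ρ ^ n) := by
    intro n
    by_cases hn : ρ ^ n ≤ 1 / 3
    · obtain ⟨C, g, h2, h3⟩ := hρ n hn
      exact ⟨C, g, by rwa [hrate], fun _ => h2⟩
    · refine ⟨Finset.univ, fun _ _ => Classical.arbitrary X, ?_, fun h => absurd h hn⟩
      have hX : (0 : ℝ) < Fintype.card X := by exact_mod_cast Fintype.card_pos
      rw [hrate, Finset.card_univ, Fintype.card_fun, Fintype.card_fin, Nat.cast_pow,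
        ← Real.exp_log (pow_pos hX n), Real.log_pow]
      refine Real.exp_le_exp.mpr (mul_le_mul_of_nonneg_left ?_ (Nat.cast_nonneg n))
      have : 0 < ε * Real.log 2 := by positivity
      linarith
  choose C g h2 h3 using hcodes
  refine ⟨C, g, fun n _ => h2 n, Filter.Tendsto.liminf_eq ?_⟩
  have hρ0 : Filter.Tendsto (fun n : ℕ => ρ ^ n) Filter.atTop (nhds 0) :=
    tendsto_pow_atTop_nhds_zero_of_lt_one h0.le h1
  refine tendsto_of_tendsto_of_tendsto_of_le_of_le' tendsto_const_nhds
    (by simpa using hρ0.const_mul 2)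
    (Filter.Eventually.of_forall fun n => decoderErrorProb_nonneg W (C n) (g n)) ?_
  filter_upwards [hρ0.eventually_le_const (show (0 : ℝ) < 1 / 3 by norm_num)] with n hn
  exact h3 n hn

end Achievability

section MismatchConverse

variable {X Y : Type} [Fintype X] [Fintype Y]

/-- If `q`-decoding errors for `V` are at most a constant factor more likely than for `W`, then the
strong converse for `V` bounds the mismatch capacity of `W`. -/
theorem mismatchCapacity_le (W V : Channel X Y) (hpos : ∀ x k, 0 < V.prob x k) (Q : Y → ℝ)
    (hQ : ∀ k, 0 < Q k) (hQ1 : ∑ k, Q k = 1) (c : ℝ) (hc0 : 0 ≤ c)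
    (hc : ∀ x, relEntropy (V.prob x) Q < c) (q : X → Y → ℝ) (N : ℝ) (hN : 0 < N)
    (hVW : ∀ (n : ℕ) (C : Finset (Fin n → X)),
      metricErrorProb V q C ≤ N * metricErrorProb W q C) :
    mismatchCapacity W q ≤ c / Real.log 2 := by
  have hlog : 0 < Real.log 2 := Real.log_pos one_lt_two
  refine Real.sSup_le (fun R hR => ?_) (by positivity)
  by_contra! hlt
  obtain ⟨C, hC, hlim⟩ := hR.2 ((R - c / Real.log 2) / 2) (by linarith)
  set γ := (R - c / Real.log 2) / 2 * Real.log 2 with hγ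
  have hγ0 : 0 < γ := mul_pos (by linarith) hlog
  obtain ⟨ρ, h0, h1, hρ⟩ := exists_strong_converse V hpos Q hQ hQ1 c hc q
  have hbound : ∀ n : ℕ, 1 ≤ n →
      1 - N * metricErrorProb W q (C n) ≤ ρ ^ n + Real.exp (-γ) ^ n := by
    intro n hn
    have hcard := hC n hn
    rw [two_rpow_eq_exp] at hcard
    have hexp : (n : ℝ) * (R - (R - c / Real.log 2) / 2) * Real.log 2 = n * c + n * γ := by
      rw [hγ]
      field_simp
      ring
    rw [hexp] at hcard
    have hCpos : (0 : ℝ) < (C n).card := lt_of_lt_of_le (Real.exp_pos _) hcard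
    have hne : (C n).Nonempty := Finset.card_pos.mp (by exact_mod_cast hCpos)
    have h2 : Real.exp (n * c) / (C n).card ≤ Real.exp (-γ) ^ n := by
      rw [div_le_iff₀ hCpos, ← Real.exp_nat_mul]
      calc Real.exp (n * c) = Real.exp (n * -γ) * Real.exp (n * c + n * γ) := by
            rw [← Real.exp_add]
            ring_nf
        _ ≤ _ := mul_le_mul_of_nonneg_left hcard (Real.exp_nonneg _)
    have := hρ n (C n) hne
    have := hVW n (C n)
    linarith
  have hzero : Filter.Tendsto (fun n : ℕ => ρ ^ n + Real.exp (-γ) ^ n) Filter.atTop (nhds 0) := by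
    simpa using (tendsto_pow_atTop_nhds_zero_of_lt_one h0.le h1).add
      (tendsto_pow_atTop_nhds_zero_of_lt_one (Real.exp_nonneg (-γ)) (by simpa using hγ0))
  have hev : ∀ᶠ n in Filter.atTop, 1 / (2 * N) ≤ metricErrorProb W q (C n) := by
    filter_upwards [hzero.eventually_le_const (show (0 : ℝ) < 1 / 2 by norm_num),
      Filter.eventually_ge_atTop 1] with n hn hn1
    have := hbound n hn1
    rw [div_le_iff₀ (by positivity)]
    linarith
  have hle : 1 / (2 * N) ≤ Filter.liminf (fun n => metricErrorProb W q (C n)) Filter.atTop :=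
    Filter.le_liminf_of_le
      (Filter.IsCoboundedUnder.of_frequently_le
        (Filter.Frequently.of_forall fun n => metricErrorProb_le_one W q (C n))) hev
  rw [hlim] at hle
  have : 0 < 1 / (2 * N) := by positivity
  linarith

end MismatchConverse

section RelEntropy

variable {Y : Type} [Fintype Y]

theorem relEntropy_self (a : Y → ℝ) : relEntropy a a = 0 := by
  simp [relEntropy]

theorem relEntropy_pos (a b : Y → ℝ) (ha : ∀ k, 0 < a k) (hb : ∀ k, 0 < b k)
    (ha1 : ∑ k, a k = 1) (hb1 : ∑ k, b k = 1) (hab : a ≠ b) : 0 < relEntropy a b := by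
  have hlog : ∀ k, Real.log (b k) - Real.log (a k) = Real.log (b k / a k) := fun k =>
    (Real.log_div (hb k).ne' (ha k).ne').symm
  have hmul : ∀ k, a k * (b k / a k - 1) = b k - a k := fun k => by
    have := (ha k).ne'
    field_simp
  have h1 : ∑ k, a k * (Real.log (b k) - Real.log (a k)) < ∑ k, (b k - a k) := by
    obtain ⟨k₀, hk₀⟩ := Function.ne_iff.mp hab
    refine Finset.sum_lt_sum (fun k _ => ?_) ⟨k₀, Finset.mem_univ _, ?_⟩
    · rw [hlog, ← hmul]
      exact mul_le_mul_of_nonneg_left (Real.log_le_sub_one_of_pos (div_pos (hb k) (ha k))) (ha k).le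
    · rw [hlog, ← hmul]
      refine mul_lt_mul_of_pos_left (Real.log_lt_sub_one_of_pos (div_pos (hb k₀) (ha k₀)) ?_) (ha k₀)
      rw [Ne, div_eq_one_iff_eq (ha k₀).ne']
      exact hk₀.symm
  have h2 : relEntropy a b = -∑ k, a k * (Real.log (b k) - Real.log (a k)) := by
    rw [relEntropy, ← Finset.sum_neg_distrib]
    exact Finset.sum_congr rfl fun k _ => by ring
  rw [Finset.sum_sub_distrib, ha1, hb1] at h1
  linarith

theorem relEntropy_le_neg_log (a b : Y → ℝ) (ha : ∀ k, 0 < a k) (ha1 : ∑ k, a k = 1) (p : ℝ)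
    (hp : 0 < p) (hb : ∀ k, p * a k ≤ b k) : relEntropy a b ≤ -Real.log p := by
  calc relEntropy a b ≤ ∑ k, a k * (-Real.log p) := by
        refine Finset.sum_le_sum fun k _ => mul_le_mul_of_nonneg_left ?_ (ha k).le
        have := Real.log_le_log (mul_pos hp (ha k)) (hb k)
        rw [Real.log_mul hp.ne' (ha k).ne'] at this
        linarith
    _ = -Real.log p := by rw [← Finset.sum_mul, ha1, one_mul]

/-- Mixing the second argument with the first shrinks the divergence. -/
theorem relEntropy_mix_le (a b : Y → ℝ) (ha : ∀ k, 0 < a k) (hb : ∀ k, 0 < b k) (t : ℝ)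
    (ht0 : 0 ≤ t) (ht1 : t ≤ 1) :
    relEntropy a (fun k => (1 - t) * b k + t * a k) ≤ (1 - t) * relEntropy a b := by
  unfold relEntropy
  rw [Finset.mul_sum]
  refine Finset.sum_le_sum fun k _ => ?_
  have h := strictConcaveOn_log_Ioi.concaveOn.2 (Set.mem_Ioi.mpr (hb k))
    (Set.mem_Ioi.mpr (ha k)) (sub_nonneg.mpr ht1) ht0 (sub_add_cancel 1 t)
  simp only [smul_eq_mul] at h
  have := mul_le_mul_of_nonneg_left h (ha k).le
  linarith

theorem continuousAt_relEntropy_mix (a b d : Y → ℝ) (hb : ∀ k, 0 < b k) :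
    ContinuousAt (fun t : ℝ => relEntropy a (fun k => (1 - t) * b k + t * d k)) 0 := by
  unfold relEntropy
  refine tendsto_finsetSum _ fun k _ => ?_
  refine ContinuousAt.mul continuousAt_const (ContinuousAt.sub continuousAt_const
    (ContinuousAt.log (by fun_prop) ?_))
  simpa using (hb k).ne'

theorem eventually_relEntropy_lt (a b m : Y → ℝ) (ha : ∀ k, 0 < a k) (hm : ∑ k, m k = 0)
    (hneg : ∑ k, m k * (Real.log (a k) - Real.log (b k)) < 0) :
    ∀ᶠ ε in nhdsWithin (0 : ℝ) (Set.Ioi 0),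
      relEntropy (fun k => a k + ε * m k) b < relEntropy a b := by
  have hd : HasDerivAt (fun ε : ℝ => relEntropy (fun k => a k + ε * m k) b)
      (∑ k, m k * (Real.log (a k) - Real.log (b k))) 0 := by
    have hterm : ∀ k ∈ (Finset.univ : Finset Y), HasDerivAt
        (fun ε : ℝ => (a k + ε * m k) * (Real.log (a k + ε * m k) - Real.log (b k)))
        (m k * (Real.log (a k) - Real.log (b k)) + m k) 0 := by
      intro k _
      have h1 : HasDerivAt (fun ε : ℝ => a k + ε * m k) (m k) 0 := by
        simpa using ((hasDerivAt_id (0 : ℝ)).mul_const (m k)).const_add (a k)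
      have h2 := h1.mul ((h1.log (by simpa using (ha k).ne')).sub_const (Real.log (b k)))
      refine h2.congr_deriv ?_
      have := (ha k).ne'
      rw [zero_mul, add_zero, mul_div_cancel₀ _ this]
    have := HasDerivAt.fun_sum hterm
    rwa [Finset.sum_add_distrib, hm, add_zero] at this
  have hev := ((hasDerivAt_iff_tendsto_slope.mp hd).mono_left
    (nhdsWithin_mono 0 fun s (hs : s ∈ Set.Ioi 0) => ne_of_gt hs)).eventually (gt_mem_nhds hneg)
  filter_upwards [hev, self_mem_nhdsWithin] with ε hε h0
  have h0' : 0 < ε := h0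
  rw [slope_def_field, sub_zero, div_lt_iff₀ h0', zero_mul] at hε
  simpa using hε

end RelEntropy

section Equidistant

variable {Y : Type} [Fintype Y]

/-- A binary-input channel has an output distribution, induced by a strictly positive input
distribution, that is equally far from both rows. -/
theorem exists_equidistant_output (W : Channel (Fin 2) Y) (hpos : ∀ j k, 0 < W.prob j k)
    (hne : W.prob 0 ≠ W.prob 1) :
    ∃ (p : Fin 2 → ℝ) (Q : Y → ℝ) (c : ℝ), (∀ j, 0 < p j) ∧ ∑ j, p j = 1 ∧
      (∀ k, Q k = ∑ j, p j * W.prob j k) ∧ (∀ k, 0 < Q k) ∧ 0 < c ∧ c ≤ Real.log 2 ∧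
      ∀ j, relEntropy (W.prob j) Q = c := by
  let Q : ℝ → Y → ℝ := fun t k => t * W.prob 0 k + (1 - t) * W.prob 1 k
  have hQpos : ∀ t ∈ Set.Icc (0 : ℝ) 1, ∀ k, 0 < Q t k := by
    intro t ht k
    have h0 := hpos 0 k
    have h1 := hpos 1 k
    have h2 : 0 ≤ t * W.prob 0 k := mul_nonneg ht.1 h0.le
    have h3 : 0 ≤ (1 - t) * W.prob 1 k := mul_nonneg (by linarith [ht.2]) h1.le
    rcases eq_or_lt_of_le ht.1 with h | h
    · simp [Q, ← h, h1]
    · have : 0 < t * W.prob 0 k := mul_pos h h0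
      simp only [Q]
      linarith
  have hQsum : ∀ t, ∑ k, Q t k = 1 := by
    intro t
    simp only [Q, Finset.sum_add_distrib, ← Finset.mul_sum, W.sum_eq_one]
    ring
  have hcont : ContinuousOn (fun t => relEntropy (W.prob 0) (Q t) - relEntropy (W.prob 1) (Q t))
      (Set.Icc 0 1) := by
    unfold relEntropy
    refine ContinuousOn.sub ?_ ?_ <;>
    · refine continuousOn_finsetSum _ fun k _ => ?_
      refine ContinuousOn.mul continuousOn_const (ContinuousOn.sub continuousOn_const
        (ContinuousOn.log (by fun_prop) fun t ht => (hQpos t ht k).ne'))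
  have hQ0 : Q 0 = W.prob 1 := by
    ext k
    simp [Q]
  have hQ1 : Q 1 = W.prob 0 := by
    ext k
    simp [Q]
  have hd01 := relEntropy_pos _ _ (hpos 0) (hpos 1) (W.sum_eq_one 0) (W.sum_eq_one 1) hne
  have hd10 := relEntropy_pos _ _ (hpos 1) (hpos 0) (W.sum_eq_one 1) (W.sum_eq_one 0) hne.symm
  obtain ⟨t, ht, hft⟩ := intermediate_value_Ioo' zero_le_one hcont (show (0 : ℝ) ∈ Set.Ioo _ _ by
    simp only [hQ0, hQ1, relEntropy_self, Set.mem_Ioo]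
    constructor <;> linarith)
  have heq : relEntropy (W.prob 0) (Q t) = relEntropy (W.prob 1) (Q t) := by
    simpa [sub_eq_zero] using hft
  have ht' := Set.Ioo_subset_Icc_self ht
  have ht1 : 0 < 1 - t := by linarith [ht.2]
  refine ⟨![t, 1 - t], Q t, relEntropy (W.prob 0) (Q t), ?_, by simp, ?_, hQpos t ht', ?_, ?_, ?_⟩
  · intro j
    fin_cases j
    · exact ht.1
    · exact ht1
  · intro k
    simp [Q]
  · refine relEntropy_pos _ _ (hpos 0) (hQpos t ht') (W.sum_eq_one 0) (hQsum t) fun h => hne ?_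
    ext k
    have hk : W.prob 0 k = t * W.prob 0 k + (1 - t) * W.prob 1 k := congrFun h k
    have : (1 - t) * W.prob 0 k = (1 - t) * W.prob 1 k := by linarith
    exact mul_left_cancel₀ ht1.ne' this
  · have hhalf : ∀ s : ℝ, 1 / 2 ≤ s → -Real.log s ≤ Real.log 2 := by
      intro s hs
      rw [← Real.log_inv]
      refine Real.log_le_log (by positivity) ?_
      rw [inv_le_comm₀ (by linarith) two_pos]
      linarith
    rcases le_total (1 / 2) t with h | h
    · refine (relEntropy_le_neg_log _ _ (hpos 0) (W.sum_eq_one 0) t ht.1 fun k => ?_).trans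
        (hhalf t h)
      have := mul_pos ht1 (hpos 1 k)
      simp only [Q]
      linarith
    · rw [heq]
      refine (relEntropy_le_neg_log _ _ (hpos 1) (W.sum_eq_one 1) (1 - t) ht1 fun k => ?_).trans
        (hhalf (1 - t) (by linarith))
      have := mul_pos ht.1 (hpos 0 k)
      simp only [Q]
      linarith
  · intro j
    fin_cases j
    · rfl
    · exact heq.symm

end Equidistant

section Transfer

variable {X Y : Type} [Fintype Y] [DecidableEq X] [DecidableEq Y]

/-- The law of a uniformly chosen member of `N` outputs, one of which is `u` and the others `w`. -/
noncomputable def sourceLaw (N : ℕ) (u w k : Y) : ℝ :=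
  ((if u = k then 1 else 0) + (N - 1) * (if w = k then 1 else 0)) / N

theorem sum_sourceLaw_mul {N : ℕ} (u w : Y) (φ : Y → ℝ) :
    ∑ k, sourceLaw N u w k * φ k = (φ u + (N - 1) * φ w) / N := by
  simp only [sourceLaw, div_mul_eq_mul_div, ← Finset.sum_div, add_mul, mul_assoc,
    Finset.sum_add_distrib, ← Finset.mul_sum, ite_mul, one_mul, zero_mul, Finset.sum_ite_eq,
    Finset.mem_univ, if_true]

theorem sum_sourceLaw {N : ℕ} [NeZero N] (u w : Y) : ∑ k, sourceLaw N u w k = 1 := by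
  have hN : (N : ℝ) ≠ 0 := Nat.cast_ne_zero.mpr (NeZero.ne N)
  have h := sum_sourceLaw_mul (N := N) u w fun _ => 1
  simp only [mul_one] at h
  rw [h, add_sub_cancel, div_self hN]

theorem sum_one_of_many {N : ℕ} (j : Fin N) (A B : ℝ) :
    ∑ s : Fin N, (if s = j then A else B) = A + (N - 1) * B := by
  have h : ∀ s : Fin N, (if s = j then A else B) = B + if s = j then A - B else 0 := by
    intro s
    split_ifs <;> ring
  simp only [h, Finset.sum_add_distrib, Finset.sum_ite_eq', Finset.mem_univ, if_true,
    Finset.sum_const, Finset.card_univ, Fintype.card_fin, nsmul_eq_mul]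
  ring

/-- The channel `W` with mass `ε` of the row `a` moved from `u` and `w`, in proportion
`1 : N - 1`, to `v`. -/
noncomputable def Channel.transfer (W : Channel X Y) (a : X) (N : ℕ) [NeZero N] (u v w : Y) (ε : ℝ)
    (hε : 0 ≤ ε) (hW : ∀ k, ε * sourceLaw N u w k ≤ W.prob a k) : Channel X Y where
  prob x k := if x = a then W.prob a k + ε * ((if v = k then 1 else 0) - sourceLaw N u w k)
    else W.prob x k
  nonneg x k := by
    have h1 := hW k
    have h2 : 0 ≤ ε * (if v = k then (1 : ℝ) else 0) := by
      refine mul_nonneg hε ?_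
      split_ifs <;> norm_num
    by_cases hx : x = a
    · rw [if_pos hx, mul_sub]
      linarith
    · rw [if_neg hx]
      exact W.nonneg x k
  sum_eq_one x := by
    split_ifs with hx
    · rw [Finset.sum_add_distrib, ← Finset.mul_sum, Finset.sum_sub_distrib, sum_sourceLaw,
        W.sum_eq_one]
      simp
    · exact W.sum_eq_one x

/-- `q`-decoding errors after a transfer of mass towards outputs for which the metric favours the
transmitted letter at least as much on average are at most `N` times as likely as before. -/
theorem metricErrorProb_transfer_le (W : Channel X Y) (q : X → Y → ℝ) (a : X) (N : ℕ) [NeZero N]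
    (u v w : Y) (ε : ℝ) (hε : 0 ≤ ε) (hW : ∀ k, ε * sourceLaw N u w k ≤ W.prob a k)
    (hq : ∀ x, (q a u - q x u) + (N - 1) * (q a w - q x w) ≤ N * (q a v - q x v))
    {n : ℕ} (C : Finset (Fin n → X)) :
    metricErrorProb (W.transfer a N u v w ε hε hW) q C ≤ N * metricErrorProb W q C := by
  have hN : (N : ℝ) ≠ 0 := Nat.cast_ne_zero.mpr (NeZero.ne N)
  let κ : X → Y ⊕ Fin N → ℝ := fun x => Sum.elim
    (fun y => if x = a then W.prob a y - ε * sourceLaw N u w y else W.prob x y)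
    (fun _ => if x = a then ε / N else 0)
  have hκ : ∀ x ω, 0 ≤ κ x ω := by
    rintro x (y | s)
    · simp only [κ, Sum.elim_inl]
      split_ifs
      · exact sub_nonneg.mpr (hW y)
      · exact W.nonneg x y
    · simp only [κ, Sum.elim_inr]
      split_ifs
      · positivity
      · exact le_rfl
  have h := metricErrorProb_le_of_coupling (J := Fin N) W (W.transfer a N u v w ε hε hW) q κ hκ
    (fun j => Sum.elim id fun s => if s = j then u else w) (Sum.elim id fun _ => v) ?_ ?_ ?_ C
  · simpa using h
  · intro j x k
    rw [Fintype.sum_sum_type]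
    change W.prob x k = (∑ y, if y = k then κ x (Sum.inl y) else 0) +
      ∑ s : Fin N, if (if s = j then u else w) = k then κ x (Sum.inr s) else 0
    simp only [κ, Sum.elim_inl, Sum.elim_inr, Finset.sum_ite_eq', Finset.mem_univ, if_true]
    by_cases hx : x = a
    · subst hx
      have hs : ∀ s : Fin N, (if (if s = j then u else w) = k then ε / N else 0) =
          if s = j then (if u = k then ε / N else 0) else (if w = k then ε / N else 0) := by
        intro s
        split_ifs <;> rfl
      simp only [if_true, hs, sum_one_of_many, sourceLaw]
      split_ifs <;> field_simp <;> ring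
    · simp [hx]
  · intro x k
    rw [Fintype.sum_sum_type]
    change _ = (∑ y, if y = k then κ x (Sum.inl y) else 0) +
      ∑ s : Fin N, if v = k then κ x (Sum.inr s) else 0
    simp only [κ, Sum.elim_inl, Sum.elim_inr, Finset.sum_ite_eq', Finset.mem_univ, if_true,
      Channel.transfer]
    by_cases hx : x = a
    · subst hx
      simp only [if_true, Finset.sum_const, Finset.card_univ, Fintype.card_fin, nsmul_eq_mul]
      split_ifs <;> field_simp <;> ring
    · simp [hx]
  · rintro x (y | s) h0 x'
    · simp only [Sum.elim_inl, id, Finset.sum_const, Finset.card_univ, nsmul_eq_mul, le_refl]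
    · have hx : x = a := by
        by_contra hx
        simp [κ, hx] at h0
      subst hx
      have hs : ∀ j : Fin N, q x' (if s = j then u else w) - q x (if s = j then u else w) =
          if j = s then q x' u - q x u else q x' w - q x w := by
        intro j
        by_cases hj : s = j <;> simp [hj, eq_comm]
      simp only [Sum.elim_inr, hs, sum_one_of_many, Fintype.card_fin]
      have := hq x'
      linarith

end Transfer

section BinaryInput

variable {Y : Type} [Fintype Y]

/-- A transfer of mass that lowers the likelihood ratio of the transmitted letter while the metric
does not notice makes the mismatch capacity fall short of the capacity. -/
theorem mismatchCapacity_lt_capacity_of_transfer (W : Channel (Fin 2) Y) (q : Fin 2 → Y → ℝ)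
    (hpos : ∀ j k, 0 < W.prob j k) (a b : Fin 2) (hab : a ≠ b) (N : ℕ) [NeZero N] (u v w : Y)
    (hq : (q a u - q b u) + (N - 1) * (q a w - q b w) ≤ N * (q a v - q b v))
    (hvw : W.prob a v * W.prob b w = W.prob a w * W.prob b v)
    (huv : W.prob a v * W.prob b u < W.prob a u * W.prob b v) :
    mismatchCapacity W q < capacity W := by
  classical
  have hcases : ∀ x : Fin 2, x = a ∨ x = b := by omega
  have hne : W.prob 0 ≠ W.prob 1 := by
    intro h
    have : W.prob a = W.prob b := by
      rcases hcases 0 with h0 | h0 <;> rcases hcases 1 with h1 | h1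
      · exact absurd (h0.trans h1.symm) (by decide)
      · rw [← h0, ← h1, h]
      · rw [← h0, ← h1, h]
      · exact absurd (h0.trans h1.symm) (by decide)
    rw [this, mul_comm] at huv
    exact lt_irrefl _ huv
  obtain ⟨p, Q, c, hp, hp1, hQ, hQ0, hc0, hc2, hc⟩ := exists_equidistant_output W hpos hne
  have hQab : ∀ k, Q k = p a * W.prob a k + p b * W.prob b k := by
    intro k
    rw [hQ, ← Finset.sum_pair (f := fun j => p j * W.prob j k) hab]
    exact Finset.sum_congr (Finset.ext fun x => by simpa using hcases x) fun _ _ => rfl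
  have hQ1 : ∑ k, Q k = 1 := by
    simp only [hQ]
    rw [Finset.sum_comm]
    simp [← Finset.mul_sum, W.sum_eq_one, hp1]
  let φ : Y → ℝ := fun k => Real.log (W.prob a k) - Real.log (Q k)
  have hφ : ∀ k, φ k = Real.log (W.prob a k / Q k) := fun k =>
    (Real.log_div (hpos a k).ne' (hQ0 k).ne').symm
  have hφvw : φ v = φ w := by
    rw [hφ, hφ]
    congr 1
    rw [div_eq_div_iff (hQ0 v).ne' (hQ0 w).ne', hQab, hQab]
    linear_combination p b * hvw
  have hφuv : φ v < φ u := by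
    rw [hφ, hφ]
    refine Real.log_lt_log (div_pos (hpos a v) (hQ0 v)) ?_
    rw [div_lt_div_iff₀ (hQ0 v) (hQ0 u), hQab, hQab]
    have := mul_lt_mul_of_pos_left huv (hp b)
    linarith
  have hN : (0 : ℝ) < N := Nat.cast_pos.mpr (NeZero.pos N)
  have hev1 := eventually_relEntropy_lt (W.prob a) Q
    (fun k => (if v = k then 1 else 0) - sourceLaw N u w k) (hpos a) (by
      rw [Finset.sum_sub_distrib, sum_sourceLaw]
      simp) (by
      have : ∑ k, ((if v = k then 1 else 0) - sourceLaw N u w k) * φ k =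
          φ v - (φ u + (N - 1) * φ w) / N := by
        simp only [sub_mul, Finset.sum_sub_distrib, sum_sourceLaw_mul]
        simp
      refine this.trans_lt ?_
      rw [sub_neg, lt_div_iff₀ hN, ← hφvw]
      linarith)
  have hev2 : ∀ᶠ ε in nhdsWithin (0 : ℝ) (Set.Ioi 0),
      ∀ k, ε * sourceLaw N u w k < W.prob a k := by
    refine Filter.eventually_all.mpr fun k => nhdsWithin_le_nhds ?_
    have hcont : Continuous fun ε : ℝ => ε * sourceLaw N u w k := by fun_prop
    exact hcont.continuousAt.eventually (gt_mem_nhds (by simpa using hpos a k))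
  obtain ⟨ε, hlt, hmass, hε⟩ := (hev1.and (hev2.and self_mem_nhdsWithin)).exists
  have hε0 : 0 < ε := hε
  let V := W.transfer a N u v w ε hε0.le fun k => (hmass k).le
  have hVa : V.prob a = fun k =>
      W.prob a k + ε * ((if v = k then 1 else 0) - sourceLaw N u w k) := by
    ext k
    simp [V, Channel.transfer]
  have hVb : V.prob b = W.prob b := by
    ext k
    simp [V, Channel.transfer, hab.symm]
  rw [← hVa, hc a] at hlt
  have hVpos : ∀ x k, 0 < V.prob x k := by
    intro x k
    rcases hcases x with rfl | rfl
    · have h1 := hmass k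
      have h2 : 0 ≤ ε * (if v = k then (1 : ℝ) else 0) := by
        refine mul_nonneg hε0.le ?_
        split_ifs <;> norm_num
      simp only [hVa, mul_sub]
      linarith
    · rw [hVb]
      exact hpos _ k
  have hev3 : ∀ᶠ t in nhdsWithin (0 : ℝ) (Set.Ioi 0),
      relEntropy (V.prob a) (fun k => (1 - t) * Q k + t * W.prob b k) < c :=
    nhdsWithin_le_nhds ((continuousAt_relEntropy_mix (V.prob a) Q (W.prob b) hQ0).eventually
      (gt_mem_nhds (by simpa using hlt)))
  have hev4 : ∀ᶠ t in nhdsWithin (0 : ℝ) (Set.Ioi 0), t < 1 :=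
    nhdsWithin_le_nhds (gt_mem_nhds one_pos)
  obtain ⟨t, hta, ht1, ht⟩ := (hev3.and (hev4.and self_mem_nhdsWithin)).exists
  have ht0 : 0 < t := ht
  have htb : relEntropy (V.prob b) (fun k => (1 - t) * Q k + t * W.prob b k) < c := by
    rw [hVb]
    refine (relEntropy_mix_le (W.prob b) Q (hpos b) hQ0 t ht0.le ht1.le).trans_lt ?_
    rw [hc b]
    have := mul_pos ht0 hc0
    linarith
  obtain ⟨c', hc', hc'c⟩ := exists_between (max_lt (max_lt hta htb) hc0)
  have hV := mismatchCapacity_le W V hVpos (fun k => (1 - t) * Q k + t * W.prob b k)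
    (fun k => add_pos (mul_pos (by linarith) (hQ0 k)) (mul_pos ht0 (hpos b k)))
    (by
      rw [Finset.sum_add_distrib, ← Finset.mul_sum, ← Finset.mul_sum, hQ1, W.sum_eq_one]
      ring)
    c' ((le_max_right _ _).trans hc'.le)
    (by
      have h1 := (le_max_left _ _).trans_lt hc'
      intro x
      rcases hcases x with rfl | rfl
      · exact (le_max_left _ _).trans_lt h1
      · exact (le_max_right _ _).trans_lt h1)
    q N hN fun n C => metricErrorProb_transfer_le W q a N u v w ε hε0.le _ (by
      intro x
      rcases hcases x with rfl | rfl
      · simp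
      · exact hq) C
  have hW := le_capacity_of_le_relEntropy W hpos p (fun j => (hp j).le) hp1 Q hQ hQ0 c hc0
    (fun x => (hc x).ge) (by simpa using hc2)
  exact hV.trans_lt ((div_lt_div_of_pos_right hc'c (Real.log_pos one_lt_two)).trans_le hW)

/-- Two outputs with the same likelihood ratio that the metric tells apart cost capacity. -/
theorem mismatchCapacity_lt_capacity_of_tie (W : Channel (Fin 2) Y) (q : Fin 2 → Y → ℝ)
    (hpos : ∀ j k, 0 < W.prob j k) (a b : Fin 2) (hab : a ≠ b) (u v w : Y)
    (hq : q a w - q b w < q a v - q b v)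
    (hvw : W.prob a v * W.prob b w = W.prob a w * W.prob b v)
    (huv : W.prob a v * W.prob b u < W.prob a u * W.prob b v) :
    mismatchCapacity W q < capacity W := by
  obtain ⟨M, hM⟩ := exists_nat_gt
    (((q a u - q b u) - (q a w - q b w)) / ((q a v - q b v) - (q a w - q b w)))
  rw [div_lt_iff₀ (by linarith)] at hM
  refine mismatchCapacity_lt_capacity_of_transfer W q hpos a b hab (M + 1) u v w ?_ hvw huv
  push_cast
  linarith

end BinaryInput

end Mismatch

theorem theorem2 (K : ℕ) (W : Mismatch.Channel (Fin 2) (Fin K)) (q : Fin 2 → Fin K → ℝ)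
    (hpos : ∀ (j : Fin 2) (k : Fin K), 0 < W.prob j k)
    (hne : W.prob 0 ≠ W.prob 1)
    (horder : ¬ Mismatch.SameOrder
      (fun k : Fin K => Real.log (W.prob 0 k) - Real.log (W.prob 1 k))
      (fun k : Fin K => q 0 k - q 1 k)) :
    Mismatch.mismatchCapacity W q < Mismatch.capacity W := by
  have hratio : ∀ k l, Real.log (W.prob 0 k) - Real.log (W.prob 1 k) ≤
      Real.log (W.prob 0 l) - Real.log (W.prob 1 l) →
      W.prob 0 k * W.prob 1 l ≤ W.prob 0 l * W.prob 1 k := by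
    intro k l h
    rw [← Real.log_le_log_iff (mul_pos (hpos _ _) (hpos _ _)) (mul_pos (hpos _ _) (hpos _ _)),
      Real.log_mul (hpos _ _).ne' (hpos _ _).ne', Real.log_mul (hpos _ _).ne' (hpos _ _).ne']
    linarith
  unfold Mismatch.SameOrder at horder
  push Not at horder
  obtain ⟨i₁, i₂, hlik, hmetric⟩ := horder
  rcases lt_or_eq_of_le (hratio i₂ i₁ hlik) with hlt | heq
  · refine Mismatch.mismatchCapacity_lt_capacity_of_transfer W q hpos 0 1 (by decide) 1 i₁ i₂ i₂
      ?_ rfl hlt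
    push_cast
    linarith
  · obtain ⟨u, hu⟩ : ∃ u, W.prob 0 i₂ * W.prob 1 u ≠ W.prob 0 u * W.prob 1 i₂ := by
      by_contra! hall
      have hsum : ∑ u, W.prob 0 i₂ * W.prob 1 u = ∑ u, W.prob 0 u * W.prob 1 i₂ :=
        Finset.sum_congr rfl fun u _ => hall u
      rw [← Finset.mul_sum, ← Finset.sum_mul, W.sum_eq_one, W.sum_eq_one, mul_one, one_mul] at hsum
      refine hne (funext fun u => ?_)
      have := hall u
      rw [hsum, mul_comm] at this
      exact (mul_right_cancel₀ (hpos 1 i₂).ne' this).symm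
    rcases lt_or_gt_of_ne hu with h | h
    · exact Mismatch.mismatchCapacity_lt_capacity_of_tie W q hpos 0 1 (by decide) u i₂ i₁
        hmetric heq h
    · refine Mismatch.mismatchCapacity_lt_capacity_of_tie W q hpos 1 0 (by decide) u i₁ i₂
        (by linarith) (by linarith) ?_
      refine lt_of_mul_lt_mul_right ?_ (hpos 0 i₂).le
      have h1 := mul_lt_mul_of_pos_right h (hpos 1 i₁)
      have h2 : W.prob 1 i₁ * W.prob 0 u * W.prob 0 i₂ * W.prob 1 i₂ <
          W.prob 1 u * W.prob 0 i₁ * W.prob 0 i₂ * W.prob 1 i₂ := by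
        have h3 := mul_lt_mul_of_pos_right h1 (hpos 0 i₂)
        have h4 : W.prob 1 u * W.prob 0 i₁ * W.prob 0 i₂ * W.prob 1 i₂ =
            W.prob 0 i₂ * W.prob 1 u * W.prob 1 i₁ * W.prob 0 i₂ := by
          linear_combination (-W.prob 1 u * W.prob 0 i₂) * heq
        linarith
      exact lt_of_mul_lt_mul_right h2 (hpos 1 i₂).le
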